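/- Let $\Sigma$ be a finite alphabet. A weighted automaton over $\mathbb{R}_{\ge 0}$ consists of a finite state set $Q$, vectors $\lambda,\mu\in\mathbb{R}_{\ge 0}^{Q}$ and matrices $M_a\in\mathbb{R}_{\ge 0}^{Q\times Q}$ for $a\in\Sigma$; it computes the function $w_1\cdots w_n\mapsto \lambda^{\top}M_{w_1}\cdots M_{w_n}\mu$ on $\Sigma^*$. Stochastic regular expressions (SREs) over $\Sigma$ are given by the grammar $$r ::= \delta_\sigma \mid \alpha r_1+(1-\alpha)r_2 \mid r_1\cdot r_2\mid r^*_\alpha ,\qquad \sigma\in\Sigma\cup\{\varepsilon\},\ \alpha\in(0,1),$$ where $r^*_\alpha$ may be formed only if $\llbracket r\rrbracket(\varepsilon)=0$. Their semantics $\llbracket r\rrbracket:\Sigma^*\to[0,1]$ is defined by: $\llbracket\delta_\sigma\rrbracket(w)=1$ if $w=\sigma$ and $0$ otherwise; $\llbracket\alpha r_1+(1-\alpha)r_2\rrbracket=\alpha\llbracket r_1\rrbracket+(1-\alpha)\llbracket r_2\rrbracket$; $\llbracket r_1\cdot r_2\rrbracket(w)=\sum_{w=uv}\llbracket r_1\rrbracket(u)\,\llbracket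 r_2\rrbracket(v)$; and $$\llbracket r^*_\alpha\rrbracket(w)=\sum_{k=1}^{\infty}\ \sum_{\substack{w=w_1\cdots w_k\\ w_i\in\Sigma^+}}\alpha(1-\alpha)^{k-1}\prod_{i=1}^{k}\llbracket r\rrbracket(w_i).$$ A function $f:\Sigma^*\to\mathbb{R}_{\ge 0}$ is computable by a weighted automaton over $\mathbb{R}_{\ge 0}$ if and only if there exist $\zeta\ge 0$, $Z\ge 0$ and an SRE $r$ such that, for all $w\in\Sigma^*$, $$f(w)=\zeta^{|w|}\cdot Z\cdot\llbracket r\rrbracket(w)$$ (with $\zeta^{0}=1$, also for $\zeta=0$). -/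

import Mathlib

open scoped NNReal

/-- A weighted finite automaton over the semiring `K`, with alphabet `σ` and state set `Q`. -/
structure WeightedAutomaton (K σ Q : Type*) where
  /-- initial weight vector -/
  init : Q → K
  /-- one transition matrix for each letter -/
  trans : σ → Matrix Q Q K
  /-- final weight vector -/
  final : Q → K

/-- The quantitative language of an automaton: `w₁ ⋯ wₙ ↦ initᵀ * M_{w₁} * ⋯ * M_{wₙ} * final`. -/
def WeightedAutomaton.language {K σ Q : Type*} [Semiring K] [Fintype Q] [DecidableEq Q]
    (A : WeightedAutomaton K σ Q) (w : List σ) : K :=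
  A.init ⬝ᵥ ((w.map A.trans).prod.mulVec A.final)

/-- `f` is computed by some weighted automaton over `K` with finitely many states. -/
def ComputableByWA {K σ : Type*} [Semiring K] (f : List σ → K) : Prop :=
  ∃ (Q : Type) (_ : Fintype Q) (_ : DecidableEq Q) (A : WeightedAutomaton K σ Q),
    ∀ w, f w = A.language w

/-- The syntax of stochastic regular expressions over `σ`: Dirac distributions at the empty word
and at single letters, convex combinations, products and geometric stars, with parameters in the
open unit interval. -/
inductive SRE (σ : Type*) where
  | eps : SRE σ
  | letter (a : σ) : SRE σ
  | convex (α : ℝ≥0) (hpos : 0 < α) (hlt : α < 1) (r₁ r₂ : SRE σ) : SRE σ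
  | mul (r₁ r₂ : SRE σ) : SRE σ
  | star (α : ℝ≥0) (hpos : 0 < α) (hlt : α < 1) (r : SRE σ) : SRE σ

namespace QLang

/-- The Dirac distribution at the word `u`. -/
noncomputable def dirac {σ : Type*} (u : List σ) : List σ → ℝ≥0 :=
  open Classical in fun w => if w = u then 1 else 0

/-- The Cauchy product: the sum of `f u * g v` over all factorisations `w = u ++ v`, each given by
the length `i` of `u`. -/
noncomputable def cauchy {σ : Type*} (f g : List σ → ℝ≥0) (w : List σ) : ℝ≥0 :=
  ∑ i ∈ Finset.range (w.length + 1), f (w.take i) * g (w.drop i)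

/-- The geometric star with parameter `α`: the sum over `k ≥ 1` and over all factorisations
`w = w₁ ⋯ wₖ` into nonempty words of `α * (1 - α) ^ (k - 1) * f w₁ * ⋯ * f wₖ`. The factorisations
of `w` into nonempty words are indexed by the compositions of the length of `w`, the number `k` of
factors being the length of the composition; there are none with `k > w.length`, so that the sum
over `k` is finite. (It is used for `α < 1` only, where the subtraction is the usual one.) -/
noncomputable def geomStar {σ : Type*} (α : ℝ≥0) (f : List σ → ℝ≥0) (w : List σ) : ℝ≥0 :=
  ∑ k ∈ Finset.Icc 1 w.length, ∑ c : Composition w.length with c.length = k,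
    α * (1 - α) ^ (k - 1) * ((w.splitWrtComposition c).map f).prod

end QLang

namespace SRE

/-- The semantics of stochastic regular expressions. -/
noncomputable def denote {σ : Type*} : SRE σ → List σ → ℝ≥0
  | eps => QLang.dirac []
  | letter a => QLang.dirac [a]
  | convex α _ _ r₁ r₂ => fun w => α * r₁.denote w + (1 - α) * r₂.denote w
  | mul r₁ r₂ => QLang.cauchy r₁.denote r₂.denote
  | star α _ _ r => QLang.geomStar α r.denote

/-- The star is applied only to expressions that give the empty word weight `0`; this is what makes
the semantics of every expression a probability distribution on words. -/
def WellFormed {σ : Type*} : SRE σ → Prop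
  | eps => True
  | letter _ => True
  | convex _ _ _ r₁ r₂ => r₁.WellFormed ∧ r₂.WellFormed
  | mul r₁ r₂ => r₁.WellFormed ∧ r₂.WellFormed
  | star _ _ _ r => r.WellFormed ∧ r.denote [] = 0

end SRE

/-! From expressions to automata: a series is recognizable when some finitely generated module
contains it and is stable under left quotients by letters. The product rule `deriv_mul` and the
fixed-point equation `star_eq` produce such modules for products and stars, and generators serve as
states.

Conversely, the series of the states of an automaton solve a linear system whose coefficients are
combinations of letters. Eliminating unknowns needs only sums, products and solutions of `X = A + A
* X` with `A [] = 0`. The obstacle is normalisation: a geometric star sums the powers of `A` only if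
the mass of `A` is below 1. Damping each letter by `ζ⁻¹` changes the mass to `∑ f w * ζ⁻¹ ^ |w|`,
which tends to `f []` as `ζ → ∞`; so it is eventually below 1 when `A [] = 0`. Requiring a
representation for all large `ζ`, with this limit, is stable under every operation and lets finitely
many expressions share one `ζ` (`exists_eq_add_mul`, `mem_of_linear_system`). -/

/-- Functions from words to nonnegative reals, multiplied by the Cauchy product. -/
structure WordSeries (σ : Type*) where
  /-- the underlying function -/
  coeff : List σ → ℝ≥0

namespace WordSeries

variable {σ : Type*}

instance : FunLike (WordSeries σ) (List σ) ℝ≥0 where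
  coe := coeff
  coe_injective f g h := by cases f; cases g; exact congrArg mk h

@[simp] theorem mk_apply (f : List σ → ℝ≥0) (w : List σ) : (⟨f⟩ : WordSeries σ) w = f w := rfl

theorem ext {f g : WordSeries σ} (h : ∀ w, f w = g w) : f = g := DFunLike.ext f g h

instance : Zero (WordSeries σ) := ⟨⟨0⟩⟩

noncomputable instance : Add (WordSeries σ) := ⟨fun f g => ⟨⇑f + ⇑g⟩⟩

noncomputable instance : SMul ℕ (WordSeries σ) := ⟨fun n f => ⟨n • ⇑f⟩⟩

noncomputable instance : SMul ℝ≥0 (WordSeries σ) := ⟨fun c f => ⟨c • ⇑f⟩⟩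

noncomputable instance : Mul (WordSeries σ) := ⟨fun f g => ⟨QLang.cauchy f g⟩⟩

noncomputable instance : One (WordSeries σ) := ⟨⟨QLang.dirac []⟩⟩

noncomputable instance : AddCommMonoid (WordSeries σ) :=
  DFunLike.coe_injective.addCommMonoid _ rfl (fun _ _ => rfl) (fun _ _ => rfl)

/-- The coefficients, as an additive homomorphism. -/
def coeHom (σ : Type*) : WordSeries σ →+ (List σ → ℝ≥0) where
  toFun f := f
  map_zero' := rfl
  map_add' _ _ := rfl

noncomputable instance : Module ℝ≥0 (WordSeries σ) :=
  Function.Injective.module ℝ≥0 (coeHom σ) DFunLike.coe_injective (fun _ _ => rfl)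

@[simp] theorem zero_apply (w : List σ) : (0 : WordSeries σ) w = 0 := rfl

@[simp] theorem add_apply (f g : WordSeries σ) (w : List σ) : (f + g) w = f w + g w := rfl

@[simp] theorem smul_apply (c : ℝ≥0) (f : WordSeries σ) (w : List σ) : (c • f) w = c * f w := rfl

@[simp] theorem one_nil : (1 : WordSeries σ) [] = 1 := by
  change QLang.dirac ([] : List σ) [] = 1
  simp [QLang.dirac]

@[simp] theorem one_cons (a : σ) (w : List σ) : (1 : WordSeries σ) (a :: w) = 0 := by
  change QLang.dirac [] (a :: w) = 0
  simp [QLang.dirac]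

theorem mul_apply (f g : WordSeries σ) (w : List σ) :
    (f * g) w = ∑ i ∈ Finset.range (w.length + 1), f (w.take i) * g (w.drop i) := rfl

/-- The left quotient by a letter. -/
def deriv (a : σ) : WordSeries σ →ₗ[ℝ≥0] WordSeries σ where
  toFun f := ⟨fun w => f (a :: w)⟩
  map_add' _ _ := rfl
  map_smul' _ _ := rfl

@[simp] theorem deriv_apply (a : σ) (f : WordSeries σ) (w : List σ) :
    deriv a f w = f (a :: w) := rfl

@[simp] theorem mul_nil (f g : WordSeries σ) : (f * g) [] = f [] * g [] := by
  simp [mul_apply]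

theorem mul_cons (f g : WordSeries σ) (a : σ) (w : List σ) :
    (f * g) (a :: w) = (deriv a f * g) w + f [] * g (a :: w) := by
  rw [mul_apply, Finset.sum_range_succ', mul_apply]
  rfl

theorem add_mul_aux (f g h : WordSeries σ) : (f + g) * h = f * h + g * h := by
  refine WordSeries.ext fun w => ?_
  simp only [mul_apply, add_apply, add_mul, Finset.sum_add_distrib]

theorem mul_add_aux (f g h : WordSeries σ) : f * (g + h) = f * g + f * h := by
  refine WordSeries.ext fun w => ?_
  simp only [mul_apply, add_apply, mul_add, Finset.sum_add_distrib]

theorem smul_mul (c : ℝ≥0) (f g : WordSeries σ) : (c • f) * g = c • (f * g) := by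
  refine WordSeries.ext fun w => ?_
  simp only [mul_apply, smul_apply, Finset.mul_sum, mul_assoc]

theorem mul_smul_comm' (c : ℝ≥0) (f g : WordSeries σ) : f * (c • g) = c • (f * g) := by
  refine WordSeries.ext fun w => ?_
  simp only [mul_apply, smul_apply, Finset.mul_sum, mul_left_comm]

theorem zero_mul_aux (f : WordSeries σ) : 0 * f = 0 := by
  refine WordSeries.ext fun w => ?_
  simp [mul_apply]

theorem mul_zero_aux (f : WordSeries σ) : f * 0 = 0 := by
  refine WordSeries.ext fun w => ?_
  simp [mul_apply]

theorem deriv_mul (a : σ) (f g : WordSeries σ) :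
    deriv a (f * g) = deriv a f * g + f [] • deriv a g := by
  refine WordSeries.ext fun w => ?_
  exact mul_cons f g a w

theorem deriv_one (a : σ) : deriv a (1 : WordSeries σ) = 0 := by
  refine WordSeries.ext fun w => ?_
  simp

theorem mul_assoc_aux (f g h : WordSeries σ) : f * g * h = f * (g * h) := by
  refine WordSeries.ext fun w => ?_
  induction w generalizing f with
  | nil => simp [mul_assoc]
  | cons a w ih =>
    rw [mul_cons, mul_cons, deriv_mul, add_mul_aux, add_apply, ih, smul_mul, smul_apply,
      mul_cons g h, mul_nil]
    ring

theorem one_mul_aux (f : WordSeries σ) : 1 * f = f := by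
  refine WordSeries.ext fun w => ?_
  cases w with
  | nil => simp
  | cons a w => rw [mul_cons, deriv_one, zero_mul_aux]; simp

theorem mul_one_aux (f : WordSeries σ) : f * 1 = f := by
  refine WordSeries.ext fun w => ?_
  induction w generalizing f with
  | nil => simp
  | cons a w ih => rw [mul_cons, ih]; simp

noncomputable instance : Semiring (WordSeries σ) where
  mul_assoc := mul_assoc_aux
  one_mul := one_mul_aux
  mul_one := mul_one_aux
  zero_mul := zero_mul_aux
  mul_zero := mul_zero_aux
  left_distrib := mul_add_aux
  right_distrib := add_mul_aux

@[simp] theorem sum_apply {ι : Type*} (s : Finset ι) (F : ι → WordSeries σ) (w : List σ) :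
    (∑ i ∈ s, F i) w = ∑ i ∈ s, F i w :=
  map_sum ((Pi.evalAddMonoidHom (fun _ : List σ => ℝ≥0) w).comp (coeHom σ)) F s

/-! ### Cauchy powers and the geometric star -/

theorem pow_apply_eq_zero {f : WordSeries σ} (hf : f [] = 0) {k : ℕ} {w : List σ}
    (h : w.length < k) : (f ^ k) w = 0 := by
  induction k generalizing w with
  | zero => omega
  | succ k ih =>
    rw [pow_succ', mul_apply]
    refine Finset.sum_eq_zero fun i _ => ?_
    rcases Nat.eq_zero_or_pos i with rfl | hi
    · simp [hf]
    · rcases Nat.eq_zero_or_pos w.length with hw | hw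
      · rw [List.eq_nil_of_length_eq_zero hw]
        simp [hf]
      · rw [ih (by rw [List.length_drop]; omega), mul_zero]

/-- The sum over all factorisations into `k` nonempty words is the `k`-th Cauchy power. -/
theorem sum_composition_eq_pow {f : WordSeries σ} (hf : f [] = 0) (k n : ℕ) (w : List σ)
    (hw : w.length = n) :
    ∑ c : Composition n with c.length = k, ((w.splitWrtCompositionAux c.blocks).map f).prod =
      (f ^ k) w := by
  induction k generalizing n w with
  | zero =>
    have hb : ∀ c : Composition n, c.length = 0 → n = 0 := fun c hc => by
      rw [← c.blocks_sum, List.eq_nil_of_length_eq_zero hc, List.sum_nil]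
    cases w with
    | nil =>
      obtain rfl : 0 = n := hw
      have hblocks : ∀ c : Composition 0, c.blocks = [] := fun c =>
        List.eq_nil_of_length_eq_zero (Nat.le_zero.1 c.length_le)
      have : Unique (Composition 0) :=
        ⟨⟨Composition.ones 0⟩, fun c => Composition.ext ((hblocks c).trans (hblocks _).symm)⟩
      rw [pow_zero, one_nil, Finset.filter_true_of_mem, Fintype.sum_unique, hblocks]
      · simp [List.splitWrtCompositionAux]
      · intro c _
        rw [Composition.length, hblocks, List.length_nil]
    | cons a w =>
      rw [pow_zero, one_cons, Finset.sum_filter]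
      refine Finset.sum_eq_zero fun c _ => if_neg fun hc => ?_
      have := hb c hc
      simp [this] at hw
  | succ k ih =>
    rw [pow_succ', mul_apply, Finset.sum_range_succ', List.take_zero, hf, zero_mul, add_zero, hw]
    have hterm : ∀ i ∈ Finset.range n, f (w.take (i + 1)) * (f ^ k) (w.drop (i + 1)) =
        ∑ c : Composition (n - (i + 1)) with c.length = k, f (w.take (i + 1)) *
          (((w.drop (i + 1)).splitWrtCompositionAux c.blocks).map f).prod := fun i _ => by
      rw [← ih (n - (i + 1)) (w.drop (i + 1)) (by rw [List.length_drop, hw]), Finset.mul_sum]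
    rw [Finset.sum_congr rfl hterm, Finset.sum_sigma']
    symm
    -- A composition with `k + 1` blocks is a first block `i + 1` followed by a composition of the
    -- remaining length.
    refine Finset.sum_bij
      (fun (p : Σ i : ℕ, Composition (n - (i + 1))) hp =>
        (⟨(p.1 + 1) :: p.2.blocks, ?_, ?_⟩ : Composition n)) ?_ ?_ ?_ ?_
    · intro i hi
      rcases List.mem_cons.1 hi with rfl | hi
      · omega
      · exact p.2.blocks_pos hi
    · rw [List.sum_cons, p.2.blocks_sum]
      have := Finset.mem_range.1 (Finset.mem_sigma.1 hp).1
      omega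
    · intro p hp
      have := (Finset.mem_filter.1 (Finset.mem_sigma.1 hp).2).2
      refine Finset.mem_filter.2 ⟨Finset.mem_univ _, ?_⟩
      simpa [Composition.length] using this
    · rintro ⟨i, c⟩ _ ⟨j, d⟩ _ h
      have h' := congrArg Composition.blocks h
      simp only [List.cons.injEq, add_left_inj] at h'
      obtain ⟨rfl, h2⟩ := h'
      rw [Composition.ext h2]
    · rintro ⟨b, hpos, hsum⟩ hc
      have hlen := (Finset.mem_filter.1 hc).2
      rcases b with _ | ⟨i, t⟩
      · simp [Composition.length] at hlen
      · have hi : 0 < i := hpos List.mem_cons_self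
        obtain ⟨j, rfl⟩ : ∃ j, i = j + 1 := ⟨i - 1, by omega⟩
        rw [List.sum_cons] at hsum
        refine ⟨⟨j, ⟨t, fun h => hpos (List.mem_cons_of_mem _ h), by omega⟩⟩, ?_, rfl⟩
        refine Finset.mem_sigma.2 ⟨Finset.mem_range.2 (by dsimp only; omega),
          Finset.mem_filter.2 ⟨Finset.mem_univ _, ?_⟩⟩
        simpa [Composition.length] using hlen
    · intro p _
      rw [List.splitWrtCompositionAux_cons, List.map_cons, List.prod_cons]

/-- The geometric star as a word series. -/
noncomputable def star (α : ℝ≥0) (f : WordSeries σ) : WordSeries σ := ⟨QLang.geomStar α f⟩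

/-- Powers beyond the length of the word vanish, so one cutoff `N` serves a word and all its
suffixes. -/
theorem star_apply_eq_sum_pow (α : ℝ≥0) {f : WordSeries σ} (hf : f [] = 0) {w : List σ} {N : ℕ}
    (hN : w.length ≤ N) :
    star α f w = ∑ k ∈ Finset.range N, α * (1 - α) ^ k * (f ^ (k + 1)) w := by
  have h1 : star α f w =
      ∑ k ∈ Finset.Icc 1 w.length, α * (1 - α) ^ (k - 1) * (f ^ k) w := by
    change ∑ k ∈ Finset.Icc 1 w.length, ∑ c : Composition w.length with c.length = k,
      α * (1 - α) ^ (k - 1) * ((w.splitWrtComposition c).map f).prod = _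
    refine Finset.sum_congr rfl fun k _ => ?_
    rw [← sum_composition_eq_pow hf k w.length w rfl, Finset.mul_sum]
    rfl
  have h2 : Finset.Icc 1 w.length ⊆ Finset.Icc 1 N := Finset.Icc_subset_Icc_right hN
  rw [h1, Finset.sum_subset h2, Finset.range_eq_Ico]
  · exact (Finset.sum_Ico_add' (fun k => α * (1 - α) ^ (k - 1) * (f ^ k) w) 0 N 1).symm
  · intro k hk hk'
    rw [Finset.mem_Icc] at hk hk'
    rw [pow_apply_eq_zero hf (by omega), mul_zero]

theorem star_eq (α : ℝ≥0) {f : WordSeries σ} (hf : f [] = 0) :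
    star α f = α • f + (1 - α) • (f * star α f) := by
  refine WordSeries.ext fun w => ?_
  -- The cutoff `w.length + 1` leaves, once the term `k = 0` is split off, exactly the cutoff
  -- `w.length` used for the suffixes.
  rw [star_apply_eq_sum_pow α hf (Nat.le_succ w.length), Finset.sum_range_succ', add_comm,
    add_apply, smul_apply, smul_apply, mul_apply]
  refine congrArg₂ _ (by simp) ?_
  · have h : ∀ i ∈ Finset.range (w.length + 1), f (w.take i) * star α f (w.drop i) =
        ∑ k ∈ Finset.range w.length,
          f (w.take i) * (α * (1 - α) ^ k * (f ^ (k + 1)) (w.drop i)) := fun i _ => by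
      rw [star_apply_eq_sum_pow α hf (N := w.length) (by simp), Finset.mul_sum]
    rw [Finset.sum_congr rfl h, Finset.sum_comm, Finset.mul_sum]
    refine Finset.sum_congr rfl fun k _ => ?_
    rw [pow_succ' f (k + 1), mul_apply, Finset.mul_sum, Finset.mul_sum]
    refine Finset.sum_congr rfl fun i _ => ?_
    ring

/-! ### Rescaling by word length, and letters -/

/-- Multiplication of the weight of every word `w` by `ζ ^ |w|`. -/
def scale (ζ : ℝ≥0) : WordSeries σ →ₗ[ℝ≥0] WordSeries σ where
  toFun f := ⟨fun w => ζ ^ w.length * f w⟩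
  map_add' _ _ := WordSeries.ext fun _ => mul_add _ _ _
  map_smul' _ _ := WordSeries.ext fun _ => mul_left_comm _ _ _

theorem scale_apply (ζ : ℝ≥0) (f : WordSeries σ) (w : List σ) :
    scale ζ f w = ζ ^ w.length * f w := rfl

@[simp] theorem scale_nil (ζ : ℝ≥0) (f : WordSeries σ) : scale ζ f [] = f [] := by
  simp [scale_apply]

theorem deriv_scale (ζ : ℝ≥0) (a : σ) (f : WordSeries σ) :
    deriv a (scale ζ f) = ζ • scale ζ (deriv a f) := by
  refine WordSeries.ext fun w => ?_
  simp only [deriv_apply, scale_apply, smul_apply, List.length_cons, pow_succ]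
  ring

theorem scale_mul (ζ : ℝ≥0) (f g : WordSeries σ) : scale ζ (f * g) = scale ζ f * scale ζ g := by
  refine WordSeries.ext fun w => ?_
  induction w generalizing f with
  | nil => simp
  | cons a w ih =>
    rw [mul_cons, deriv_scale, smul_mul, smul_apply, ← ih, scale_apply, mul_cons, scale_apply,
      scale_nil, scale_apply, List.length_cons, pow_succ]
    ring

theorem scale_one (ζ : ℝ≥0) : scale ζ (1 : WordSeries σ) = 1 := by
  refine WordSeries.ext fun w => ?_
  cases w <;> simp [scale_apply]

/-- The series of a single letter. -/
noncomputable def letter (a : σ) : WordSeries σ := ⟨QLang.dirac [a]⟩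

@[simp] theorem letter_nil (a : σ) : letter a [] = 0 := by
  simp [letter, QLang.dirac]

theorem deriv_letter_self (a : σ) : deriv a (letter a) = 1 := by
  refine WordSeries.ext fun w => ?_
  cases w <;> simp [letter, QLang.dirac]

theorem deriv_letter_of_ne {a b : σ} (h : b ≠ a) : deriv b (letter a) = 0 := by
  refine WordSeries.ext fun w => ?_
  simp [letter, QLang.dirac, h]

/-! ### Series computed by weighted automata -/

/-- A series is recognizable if it lies in a finitely generated module of series closed under left
quotients. -/
def Recognizable (f : WordSeries σ) : Prop :=
  ∃ N : Submodule ℝ≥0 (WordSeries σ), N.FG ∧ (∀ a, ∀ g ∈ N, deriv a g ∈ N) ∧ f ∈ N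

/-- The generators are the states: transitions expand their quotients in the generators, final
weights are their values at the empty word, and initial weights expand `f`. -/
theorem Recognizable.computableByWA {f : WordSeries σ} (hf : Recognizable f) :
    ComputableByWA ⇑f := by
  obtain ⟨N, hfg, hd, hfN⟩ := hf
  obtain ⟨n, F, rfl⟩ := Submodule.fg_iff_exists_fin_generating_family.1 hfg
  obtain ⟨c, hc⟩ := (Submodule.mem_span_range_iff_exists_fun ℝ≥0).1 hfN
  have hM : ∀ a i, ∃ m : Fin n → ℝ≥0, ∑ j, m j • F j = deriv a (F i) := fun a i =>
    (Submodule.mem_span_range_iff_exists_fun ℝ≥0).1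
      (hd a _ (Submodule.subset_span (Set.mem_range_self i)))
  choose M hM using hM
  have key : ∀ w : List σ, ∀ i,
      (w.map fun a => Matrix.of (M a)).prod.mulVec (fun j => F j []) i = F i w := by
    intro w
    induction w with
    | nil => simp
    | cons a w ih =>
      intro i
      rw [List.map_cons, List.prod_cons, ← Matrix.mulVec_mulVec, funext ih, ← deriv_apply a (F i), ← hM]
      simp [Matrix.mulVec, dotProduct]
  refine ⟨Fin n, inferInstance, inferInstance, ⟨c, fun a => Matrix.of (M a), fun j => F j []⟩,
    fun w => ?_⟩
  rw [WeightedAutomaton.language, funext (key w), ← hc]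
  simp [dotProduct]

namespace Recognizable

theorem one : Recognizable (1 : WordSeries σ) := by
  refine ⟨Submodule.span ℝ≥0 {1}, Submodule.fg_span (Set.finite_singleton _), fun a g hg => ?_,
    Submodule.subset_span rfl⟩
  obtain ⟨c, rfl⟩ := Submodule.mem_span_singleton.1 hg
  rw [map_smul, deriv_one, smul_zero]
  exact zero_mem _

theorem letter (a : σ) : Recognizable (letter a) := by
  refine ⟨Submodule.span ℝ≥0 {1, WordSeries.letter a},
    Submodule.fg_span (Set.toFinite _), fun b g hg => ?_,
    Submodule.subset_span (Set.mem_insert_of_mem _ rfl)⟩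
  obtain ⟨c, d, rfl⟩ := Submodule.mem_span_pair.1 hg
  rw [map_add, map_smul, map_smul, deriv_one, smul_zero, zero_add]
  refine Submodule.smul_mem _ _ ?_
  by_cases h : b = a
  · rw [h, deriv_letter_self]
    exact Submodule.subset_span (Set.mem_insert _ _)
  · rw [deriv_letter_of_ne h]
    exact zero_mem _

theorem smul {f : WordSeries σ} (hf : Recognizable f) (c : ℝ≥0) : Recognizable (c • f) := by
  obtain ⟨N, hfg, hd, hfN⟩ := hf
  exact ⟨N, hfg, hd, N.smul_mem c hfN⟩

theorem add {f g : WordSeries σ} (hf : Recognizable f) (hg : Recognizable g) :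
    Recognizable (f + g) := by
  obtain ⟨N, hfg, hd, hfN⟩ := hf
  obtain ⟨N', hfg', hd', hgN⟩ := hg
  refine ⟨N ⊔ N', hfg.sup hfg', fun a h hh => ?_, Submodule.add_mem_sup hfN hgN⟩
  obtain ⟨x, hx, y, hy, rfl⟩ := Submodule.mem_sup.1 hh
  rw [map_add]
  exact Submodule.add_mem_sup (hd a x hx) (hd' a y hy)

/-- Right multiplication as a linear map. -/
noncomputable def mulRight (g : WordSeries σ) : WordSeries σ →ₗ[ℝ≥0] WordSeries σ where
  toFun f := f * g
  map_add' f h := add_mul f h g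
  map_smul' c f := smul_mul c f g

theorem mul {f g : WordSeries σ} (hf : Recognizable f) (hg : Recognizable g) :
    Recognizable (f * g) := by
  obtain ⟨N, hfg, hd, hfN⟩ := hf
  obtain ⟨N', hfg', hd', hgN⟩ := hg
  refine ⟨N.map (mulRight g) ⊔ N', (hfg.map _).sup hfg', fun a h hh => ?_,
    Submodule.mem_sup_left (Submodule.mem_map_of_mem (f := mulRight g) hfN)⟩
  obtain ⟨_, ⟨x, hx, rfl⟩, y, hy, rfl⟩ := Submodule.mem_sup.1 hh
  have h1 : deriv a (mulRight g x) = mulRight g (deriv a x) + x [] • deriv a g := deriv_mul a x g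
  rw [map_add, h1, add_assoc]
  exact Submodule.add_mem_sup (Submodule.mem_map_of_mem (hd a x hx))
    (add_mem (N'.smul_mem _ (hd' a g hgN)) (hd' a y hy))

/-- With `S` the star, `N + N * S` is stable: quotients of `x * S` involve a multiple of a quotient
of `S`, which `star_eq` puts back into this module. -/
theorem star {f : WordSeries σ} (hf : Recognizable f) (h0 : f [] = 0) (α : ℝ≥0) :
    Recognizable (star α f) := by
  obtain ⟨N, hfg, hd, hfN⟩ := hf
  set S := WordSeries.star α f
  have hSeq : S = α • f + (1 - α) • mulRight S f := star_eq α h0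
  have hdS : ∀ a, deriv a S ∈ N ⊔ N.map (mulRight S) := fun a => by
    have h1 : deriv a (mulRight S f) = mulRight S (deriv a f) := by
      have := deriv_mul a f S
      rwa [h0, zero_smul, add_zero] at this
    rw [hSeq, map_add, map_smul, map_smul, ← hSeq, h1]
    exact Submodule.add_mem_sup (N.smul_mem _ (hd a f hfN))
      (Submodule.smul_mem _ _ (Submodule.mem_map_of_mem (hd a f hfN)))
  refine ⟨N ⊔ N.map (mulRight S), hfg.sup (hfg.map _), fun a h hh => ?_, ?_⟩
  · obtain ⟨y, hy, _, ⟨x, hx, rfl⟩, rfl⟩ := Submodule.mem_sup.1 hh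
    have h1 : deriv a (mulRight S x) = mulRight S (deriv a x) + x [] • deriv a S := deriv_mul a x S
    rw [map_add, h1, ← add_assoc]
    exact add_mem (Submodule.add_mem_sup (hd a y hy) (Submodule.mem_map_of_mem (hd a x hx)))
      (Submodule.smul_mem _ _ (hdS a))
  · have h1 : α • f + (1 - α) • mulRight S f ∈ N ⊔ N.map (mulRight S) :=
      Submodule.add_mem_sup (N.smul_mem _ hfN)
        (Submodule.smul_mem _ _ (Submodule.mem_map_of_mem hfN))
    rwa [← hSeq] at h1

theorem scale {f : WordSeries σ} (hf : Recognizable f) (ζ : ℝ≥0) : Recognizable (scale ζ f) := by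
  obtain ⟨N, hfg, hd, hfN⟩ := hf
  refine ⟨N.map (WordSeries.scale ζ), hfg.map _, fun a h hh => ?_, Submodule.mem_map_of_mem hfN⟩
  obtain ⟨x, hx, rfl⟩ := hh
  rw [deriv_scale]
  exact Submodule.smul_mem _ _ (Submodule.mem_map_of_mem (hd a x hx))

theorem denote (r : SRE σ) (hr : r.WellFormed) : Recognizable (⟨r.denote⟩ : WordSeries σ) := by
  induction r with
  | eps => exact one
  | letter a => exact letter a
  | convex α _ _ r₁ r₂ ih₁ ih₂ => exact ((ih₁ hr.1).smul α).add ((ih₂ hr.2).smul (1 - α))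
  | mul r₁ r₂ ih₁ ih₂ => exact (ih₁ hr.1).mul (ih₂ hr.2)
  | star α _ _ r ih => exact (ih hr.1).star hr.2 α

end Recognizable

/-! ### Linear systems of series -/

/-- Arden's rule: a linear equation without constant coefficient has at most one solution. -/
theorem eq_of_eq_add_mul {A B F G : WordSeries σ} (hA : A [] = 0) (hF : F = B + A * F)
    (hG : G = B + A * G) : F = G := by
  have h : ∀ (n : ℕ) (w : List σ), w.length = n → F w = G w := by
    intro n
    induction n using Nat.strong_induction_on with
    | _ n ih =>
      intro w hw
      rw [hF, hG, add_apply, add_apply, mul_apply, mul_apply]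
      congr 1
      -- As `A [] = 0`, only values at strictly shorter suffixes matter.
      refine Finset.sum_congr rfl fun i hi => ?_
      rcases Nat.eq_zero_or_pos i with rfl | hi
      · simp [hA]
      · rcases Nat.eq_zero_or_pos w.length with hw0 | hw0
        · rw [List.eq_nil_of_length_eq_zero hw0]
          simp [hA]
        · rw [ih (w.drop i).length (by rw [List.length_drop]; omega) _ rfl]
  exact ext fun w => h _ w rfl

/-- A set of series closed under solving linear equations contains the solutions of all linear
systems over it whose coefficients have no constant term. -/
theorem mem_of_linear_system (C : Subsemiring (WordSeries σ))
    (hC : ∀ A ∈ C, A [] = 0 → ∃ X ∈ C, X = A + A * X) (n : ℕ)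
    (A : Fin n → Fin n → WordSeries σ) (B F : Fin n → WordSeries σ)
    (hA : ∀ i j, A i j ∈ C) (hA0 : ∀ i j, A i j [] = 0) (hB : ∀ i, B i ∈ C)
    (hF : ∀ i, F i = B i + ∑ j, A i j * F j) (i : Fin n) : F i ∈ C := by
  induction n with
  | zero => exact i.elim0
  | succ n ih =>
    -- Here `1 + X` plays the role of the Kleene star of `A 0 0`; it eliminates the unknown `F 0`.
    obtain ⟨X, hX, hXeq⟩ := hC (A 0 0) (hA 0 0) (hA0 0 0)
    set R := B 0 + ∑ j : Fin n, A 0 j.succ * F j.succ with hR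
    have hF0 : F 0 = (1 + X) * R := by
      refine eq_of_eq_add_mul (A := A 0 0) (B := R) (hA0 0 0) ?_ ?_
      · conv_lhs => rw [hF 0, Fin.sum_univ_succ]
        rw [hR]
        abel
      · rw [← mul_assoc, mul_add (A 0 0), mul_one, ← hXeq, add_mul, one_mul]
    have hsucc : ∀ i : Fin n, F i.succ ∈ C := by
      refine ih (fun i j => A i.succ j.succ + A i.succ 0 * ((1 + X) * A 0 j.succ))
        (fun i => B i.succ + A i.succ 0 * ((1 + X) * B 0)) (fun i => F i.succ) ?_ ?_ ?_ ?_
      · exact fun i j => add_mem (hA _ _) (mul_mem (hA _ _)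
          (mul_mem (add_mem (one_mem _) hX) (hA _ _)))
      · intro i j
        simp [hA0]
      · exact fun i => add_mem (hB _) (mul_mem (hA _ _)
          (mul_mem (add_mem (one_mem _) hX) (hB _)))
      · intro i
        rw [hF i.succ, Fin.sum_univ_succ, hF0, hR]
        simp only [add_mul _ _ (F _), mul_add _ (B 0), Finset.mul_sum, Finset.sum_add_distrib,
          mul_assoc, mul_add (A _ _)]
        abel
    refine Fin.cases ?_ hsucc i
    rw [hF0]
    exact mul_mem (add_mem (one_mem _) hX)
      (add_mem (hB 0) (sum_mem fun j _ => mul_mem (hA _ _) (hsucc j)))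

theorem mem_of_computableByWA [Fintype σ] (C : Subsemiring (WordSeries σ))
    (hC : ∀ A ∈ C, A [] = 0 → ∃ X ∈ C, X = A + A * X)
    (hsmul : ∀ (c : ℝ≥0), ∀ f ∈ C, c • f ∈ C) (hletter : ∀ a : σ, letter a ∈ C)
    {f : WordSeries σ} (hf : ComputableByWA ⇑f) : f ∈ C := by
  classical
  obtain ⟨Q, _, _, M, hM⟩ := hf
  let F : Q → WordSeries σ := fun q => ⟨fun w => (w.map M.trans).prod.mulVec M.final q⟩
  have hcons : ∀ q a w, F q (a :: w) = ∑ p, M.trans a q p * F p w := fun q a w => by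
    change ((a :: w).map M.trans).prod.mulVec M.final q = _
    rw [List.map_cons, List.prod_cons, ← Matrix.mulVec_mulVec]
    rfl
  -- Decomposition of a run according to its first letter.
  have hsys : ∀ q, F q = M.final q • 1 + ∑ p, (∑ a, M.trans a q p • letter a) * F p := by
    intro q
    refine WordSeries.ext fun w => ?_
    cases w with
    | nil => simp [F]
    | cons b w =>
      have hd : ∀ p, deriv b (∑ a, M.trans a q p • letter a) = M.trans b q p • 1 := fun p => by
        rw [map_sum, Finset.sum_eq_single b]
        · rw [map_smul, deriv_letter_self]
        · intro a _ hab
          rw [map_smul, deriv_letter_of_ne hab.symm, smul_zero]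
        · simp
      rw [hcons, add_apply, smul_apply, one_cons, mul_zero, zero_add, sum_apply]
      refine Finset.sum_congr rfl fun p _ => ?_
      rw [mul_cons, hd, smul_mul, one_mul]
      simp
  let e := Fintype.equivFin Q
  have hFmem : ∀ i, F (e.symm i) ∈ C := by
    refine mem_of_linear_system C hC _
      (fun i j => ∑ a, M.trans a (e.symm i) (e.symm j) • letter a)
      (fun i => M.final (e.symm i) • 1) (fun i => F (e.symm i)) ?_ ?_ ?_ ?_
    · exact fun i j => sum_mem fun a _ => hsmul _ _ (hletter a)
    · intro i j
      simp
    · exact fun i => hsmul _ _ (one_mem _)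
    · intro i
      rw [hsys (e.symm i)]
      congr 1
      exact (e.symm.sum_comp fun p => (∑ a, M.trans a (e.symm i) p • letter a) * F p).symm
  have hfF : f = ∑ q, M.init q • F q := by
    refine WordSeries.ext fun w => ?_
    rw [hM w, sum_apply]
    rfl
  rw [hfF]
  refine sum_mem fun q _ => hsmul _ _ ?_
  simpa using hFmem (e q)

/-! ### Series given by scaled stochastic regular expressions -/

open Filter Topology

/-- `f` equals `Z ζ • scale ζ r` for a stochastic regular expression `r`, for all large `ζ`, where
the masses `Z ζ` tend to the weight of the empty word. -/
def EventuallyStochastic (f : WordSeries σ) : Prop :=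
  ∃ Z : ℝ≥0 → ℝ≥0, Tendsto Z atTop (𝓝 (f [])) ∧
    ∀ᶠ ζ in atTop, ∃ r : SRE σ, r.WellFormed ∧ f = Z ζ • scale ζ ⟨r.denote⟩

theorem scale_denote_convex (ζ α : ℝ≥0) (hpos : 0 < α) (hlt : α < 1) (r₁ r₂ : SRE σ) :
    scale ζ ⟨(SRE.convex α hpos hlt r₁ r₂).denote⟩ =
      α • scale ζ ⟨r₁.denote⟩ +
        (1 - α) • scale ζ ⟨r₂.denote⟩ := by
  rw [← map_smul, ← map_smul, ← map_add]
  rfl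

namespace EventuallyStochastic

theorem zero : EventuallyStochastic (0 : WordSeries σ) :=
  ⟨fun _ => 0, tendsto_const_nhds, Eventually.of_forall fun _ => ⟨.eps, trivial, by simp⟩⟩

theorem one : EventuallyStochastic (1 : WordSeries σ) :=
  ⟨fun _ => 1, by simp, Eventually.of_forall fun ζ =>
    ⟨.eps, trivial, by rw [one_smul]; exact (scale_one ζ).symm⟩⟩

theorem letter (a : σ) : EventuallyStochastic (letter a) := by
  refine ⟨fun ζ => ζ⁻¹, ?_, ?_⟩
  · rw [letter_nil]
    exact tendsto_inv_atTop_zero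
  · filter_upwards [eventually_gt_atTop 0] with ζ hζ
    refine ⟨.letter a, trivial, ?_⟩
    refine WordSeries.ext fun w => ?_
    change QLang.dirac [a] w = ζ⁻¹ * (ζ ^ w.length * QLang.dirac [a] w)
    by_cases h : w = [a]
    · rw [h, List.length_singleton, pow_one, inv_mul_cancel_left₀ hζ.ne']
    · simp [QLang.dirac, h]

theorem smul {f : WordSeries σ} (hf : EventuallyStochastic f) (c : ℝ≥0) :
    EventuallyStochastic (c • f) := by
  obtain ⟨Z, hZ, hr⟩ := hf
  refine ⟨fun ζ => c * Z ζ, hZ.const_mul c, hr.mono fun ζ ⟨r, hwf, h⟩ => ⟨r, hwf, ?_⟩⟩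
  rw [mul_smul, ← h]

theorem add {f g : WordSeries σ} (hf : EventuallyStochastic f) (hg : EventuallyStochastic g) :
    EventuallyStochastic (f + g) := by
  obtain ⟨Z, hZ, hr⟩ := hf
  obtain ⟨Y, hY, hs⟩ := hg
  refine ⟨fun ζ => Z ζ + Y ζ, hZ.add hY, ?_⟩
  filter_upwards [hr, hs] with ζ ⟨r, hwr, hr⟩ ⟨s, hws, hs⟩
  -- Convex weights must lie strictly between 0 and 1, so vanishing masses are treated apart.
  rcases eq_zero_or_pos (Z ζ) with h0 | hZpos
  · refine ⟨s, hws, ?_⟩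
    rw [hr, h0, zero_smul, zero_add, zero_add, hs]
  rcases eq_zero_or_pos (Y ζ) with h0 | hYpos
  · refine ⟨r, hwr, ?_⟩
    rw [hs, h0, zero_smul, add_zero, add_zero, hr]
  have hsum : Z ζ + Y ζ ≠ 0 := (add_pos hZpos hYpos).ne'
  have hlt : Z ζ / (Z ζ + Y ζ) < 1 :=
    (div_lt_one (add_pos hZpos hYpos)).2 (lt_add_of_pos_right _ hYpos)
  have hsub : 1 - Z ζ / (Z ζ + Y ζ) = Y ζ / (Z ζ + Y ζ) := by
    rw [tsub_eq_iff_eq_add_of_le hlt.le, ← add_div, add_comm, div_self hsum]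
  refine ⟨.convex _ (div_pos hZpos (add_pos hZpos hYpos)) hlt r s, ⟨hwr, hws⟩, ?_⟩
  rw [scale_denote_convex, hsub, smul_add, smul_smul, smul_smul, mul_div_cancel₀ _ hsum,
    mul_div_cancel₀ _ hsum, ← hr, ← hs]

theorem mul {f g : WordSeries σ} (hf : EventuallyStochastic f) (hg : EventuallyStochastic g) :
    EventuallyStochastic (f * g) := by
  obtain ⟨Z, hZ, hr⟩ := hf
  obtain ⟨Y, hY, hs⟩ := hg
  refine ⟨fun ζ => Z ζ * Y ζ, by rw [mul_nil]; exact hZ.mul hY, ?_⟩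
  filter_upwards [hr, hs] with ζ ⟨r, hwr, hr⟩ ⟨s, hws, hs⟩
  refine ⟨.mul r s, ⟨hwr, hws⟩, ?_⟩
  have h : scale ζ ⟨(SRE.mul r s).denote⟩ =
      scale ζ ⟨r.denote⟩ * scale ζ ⟨s.denote⟩ :=
    scale_mul ζ _ _
  conv_lhs => rw [hr, hs]
  rw [h, smul_mul, mul_smul_comm', smul_smul]

/-- If `A` has damped mass `Z < 1`, the star with `1 - α = Z` weights the powers of the expression
as the solution does, up to the factor `Z + Z ^ 2 + ⋯ = Z / (1 - Z)`. -/
theorem exists_eq_add_mul {A : WordSeries σ} (hA : EventuallyStochastic A) (hA0 : A [] = 0) :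
    ∃ X, EventuallyStochastic X ∧ X = A + A * X := by
  obtain ⟨Z, hZ, hr⟩ := hA
  rw [hA0] at hZ
  have hsol : ∀ᶠ ζ in atTop, ∃ X : WordSeries σ, X = A + A * X ∧
      ∃ r : SRE σ, r.WellFormed ∧
        X = (Z ζ / (1 - Z ζ)) • scale ζ ⟨r.denote⟩ := by
    filter_upwards [hr, hZ.eventually_lt_const one_pos] with ζ ⟨r, hwr, hr⟩ hlt
    rcases eq_zero_or_pos (Z ζ) with h0 | hpos
    · rw [h0, zero_smul] at hr
      exact ⟨0, by simp [hr], .eps, trivial, by simp [h0]⟩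
    have hr0 : r.denote [] = 0 := by
      have h := hA0
      rw [hr, smul_apply, scale_nil] at h
      exact (mul_eq_zero.1 h).resolve_left hpos.ne'
    have hαpos : 0 < 1 - Z ζ := tsub_pos_of_lt hlt
    have hαlt : 1 - Z ζ < 1 := tsub_lt_self one_pos hpos
    have hα : 1 - (1 - Z ζ) = Z ζ := tsub_tsub_cancel_of_le hlt.le
    refine ⟨_, ?_, .star (1 - Z ζ) hαpos hαlt r, ⟨hwr, hr0⟩, rfl⟩
    set S : WordSeries σ := ⟨(SRE.star (1 - Z ζ) hαpos hαlt r).denote⟩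
    set D : WordSeries σ := ⟨r.denote⟩
    have hSeq : S = (1 - Z ζ) • D + (1 - (1 - Z ζ)) • (D * S) := star_eq (1 - Z ζ) hr0
    rw [hα] at hSeq
    rw [hr, smul_mul, mul_smul_comm', ← scale_mul]
    conv_lhs => rw [hSeq]
    rw [map_add, map_smul, map_smul, smul_add, smul_smul, div_mul_cancel₀ _ hαpos.ne',
      smul_comm]
  -- The solutions found for different `ζ` coincide by Arden's rule, so any one of them may be
  -- fixed.
  obtain ⟨ζ₀, X, hX, -⟩ := hsol.exists
  refine ⟨X, ⟨fun ζ => Z ζ / (1 - Z ζ), ?_, ?_⟩, hX⟩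
  · have hX0 : X [] = 0 := by rw [hX, add_apply, mul_nil, hA0, zero_mul, add_zero]
    have h1 : Tendsto (fun ζ => 1 - Z ζ) atTop (𝓝 (1 - 0)) := tendsto_const_nhds.sub hZ
    have h2 := hZ.div h1 (by simp)
    rwa [zero_div, ← hX0] at h2
  · filter_upwards [hsol] with ζ ⟨Y, hY, hs⟩
    rwa [eq_of_eq_add_mul hA0 hX hY]

end EventuallyStochastic

/-- The eventually stochastic series form a subsemiring. -/
def eventuallyStochastic (σ : Type*) : Subsemiring (WordSeries σ) where
  carrier := {f | EventuallyStochastic f}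
  mul_mem' := EventuallyStochastic.mul
  one_mem' := EventuallyStochastic.one
  add_mem' := EventuallyStochastic.add
  zero_mem' := EventuallyStochastic.zero

theorem EventuallyStochastic.of_computableByWA [Fintype σ] {f : WordSeries σ}
    (hf : ComputableByWA ⇑f) : EventuallyStochastic f :=
  mem_of_computableByWA (eventuallyStochastic σ) (fun _ hA hA0 => hA.exists_eq_add_mul hA0)
    (fun c _ hf => hf.smul c) EventuallyStochastic.letter hf

end WordSeries

theorem corollary4p4 {σ : Type*} [Fintype σ] (f : List σ → ℝ≥0) :
    ComputableByWA f ↔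
      ∃ (ζ Z : ℝ≥0) (r : SRE σ), r.WellFormed ∧
        ∀ w : List σ, f w = ζ ^ w.length * Z * r.denote w := by
  constructor
  · intro hf
    obtain ⟨Z, -, hr⟩ := WordSeries.EventuallyStochastic.of_computableByWA (f := ⟨f⟩) hf
    obtain ⟨ζ, r, hwr, h⟩ := hr.exists
    refine ⟨ζ, Z ζ, r, hwr, fun w => ?_⟩
    rw [← WordSeries.mk_apply f, h, WordSeries.smul_apply, WordSeries.scale_apply,
      WordSeries.mk_apply]
    ring
  · rintro ⟨ζ, Z, r, hwr, h⟩
    have hf : f = ⇑(Z • WordSeries.scale ζ ⟨r.denote⟩) := by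
      funext w
      rw [h, WordSeries.smul_apply, WordSeries.scale_apply, WordSeries.mk_apply]
      ring
    rw [hf]
    exact (((WordSeries.Recognizable.denote r hwr).scale ζ).smul Z).computableByWA
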